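/- All groups and sets below are countable and discrete. For a finite set $B$ let $\mathrm{Sym}(B)$ be its symmetric group with the normalized Hamming distance $d(\sigma,\tau)=\frac{1}{|B|}|\{b\in B:\sigma(b)\neq\tau(b)\}|$. For a group $K$, a finite $F\subseteq K$ and $\epsilon>0$, a map $\varphi:K\to\mathrm{Sym}(B)$ is called unital if $\varphi(1)=1$, and $(F,\epsilon)$-multiplicative if $d(\varphi(gh),\varphi(g)\varphi(h))<\epsilon$ for all $g,h\in F$. The group $K$ is *sofic* if for all finite $F\subseteq K$ and $\epsilon>0$ there are a finite set $B$ and a unital, $(F,\epsilon)$-multiplicative map $\varphi:K\to\mathrm{Sym}(B)$ with $d(1,\varphi(g))>1-\epsilon$ for all $g\in F\setminus\{1\}$. An action $\alpha:K\curvearrowright X$ on a set is *sofic* if for all finite $F\subseteq K$, $E\subseteq X$ and $\epsilon>0$ there are a finite set $B$ and a unital, $(F,\epsilon)$-multiplicative map $\varphi:K\to\mathrm{Sym}(B)$ which is an $(F,E,\epsilon)$-orbit approximation of $\alpha$: there are a finite set $C$, a subset $S\subseteq B$ with $|S|>(1-\epsilon)|B|$ and injective maps $\pi_s:E\to C$ $(s\in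 S)$ such that $\pi_{\varphi(g)s}(x)=\pi_s(\alpha(g^{-1})x)$ for all $s\in S$, $g\in F$, $x\in E$ with $\varphi(g)s\in S$ and $\alpha(g^{-1})x\in E$. For a subgroup $A\leq G$ and a set $I$, let $\ast_A^{i\in I}G_i$ be the free product of copies $G_i$ of $G$, amalgamated over $A$ (for $I=\emptyset$ it is $A$). For an action $\alpha:H\curvearrowright X$, the *amalgamated free generalized wreath product* is the semidirect product $G\wr^{\ast_A}_\alpha H=(\ast_A^{x\in X}G_x)\rtimes H$, where $h\in H$ carries the copy $G_x$ identically onto $G_{\alpha(h)x}$; for $A=\{1\}$ it is called the *free generalized wreath product* $G\wr^{\ast}_\alpha H$. A group is *amenable* if it satisfies the Følner condition: for every finite $K_0\subseteq K$ and $\epsilon>0$ there is a nonempty finite $T\subseteq K$ with $|gT\,\triangle\,T|<\epsilon|T|$ for all $g\in K_0$. **Theorem 3.6.** Let $H$ be a sofic group, $\alpha:H\curvearrowright X$ a sofic action on a countable set, and $G$ a countable group. 1. If $A\leq G$ is a subgroup such that $\ast_A^{i\in I}G_i$ is sofic for every countable index set $I$, then $G\wr^{\ast_A}_\alpha H$ is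 sofic. 2. If $G$ is sofic, then the free generalized wreath product $G\wr^{\ast}_\alpha H$ is sofic. 3. If $G$ is sofic and $A\leq G$ is an amenable subgroup, then $G\wr^{\ast_A}_\alpha H$ is sofic. -/

import Mathlib

/-- The normalized Hamming distance `|{a | σ a ≠ τ a}| / |A|` on the symmetric group of a finite
set `A`. -/
noncomputable def normHamming {A : Type*} [Fintype A] [DecidableEq A]
    (σ τ : Equiv.Perm A) : ℝ :=
  (hammingDist (fun a => σ a) (fun a => τ a) : ℝ) / (Fintype.card A : ℝ)

/-- `φ : G → Sym(A)` is `(F, ε)`-multiplicative. -/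
def IsMultiplicativeUpTo {G A : Type*} [Group G] [Fintype A] [DecidableEq A]
    (φ : G → Equiv.Perm A) (F : Finset G) (ε : ℝ) : Prop :=
  ∀ g ∈ F, ∀ h ∈ F, normHamming (φ (g * h)) (φ g * φ h) < ε

/-- `φ : G → Sym(A)` is an `(F, E, ε)`-orbit approximation of the action of `G` on `X`: there are a
finite set `B`, a subset `S ⊆ A` with `|S| > (1 - ε)|A|` and injective maps `π s : E ↪ B` for
`s ∈ S` such that `π (φ(g) s) x = π s (g⁻¹ x)` whenever both sides make sense. -/
def IsOrbitApprox {G X A : Type*} [Group G] [MulAction G X] [Fintype A]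
    (φ : G → Equiv.Perm A) (F : Finset G) (E : Finset X) (ε : ℝ) : Prop :=
  ∃ (B : Type) (_ : Finite B) (S : Finset A) (π : {s // s ∈ S} → ({x // x ∈ E} ↪ B)),
    (S.card : ℝ) > (1 - ε) * (Fintype.card A : ℝ) ∧
    ∀ (s : A) (hs : s ∈ S), ∀ g ∈ F, ∀ (x : X) (hx : x ∈ E)
      (hgs : φ g s ∈ S) (hgx : g⁻¹ • x ∈ E),
      π ⟨φ g s, hgs⟩ ⟨x, hx⟩ = π ⟨s, hs⟩ ⟨g⁻¹ • x, hgx⟩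

/-- Sofic groups. -/
def IsSofic (G : Type*) [Group G] : Prop :=
  ∀ (F : Finset G) (ε : ℝ), 0 < ε →
    ∃ (A : Type) (_ : Fintype A) (_ : DecidableEq A) (φ : G → Equiv.Perm A),
      φ 1 = 1 ∧ IsMultiplicativeUpTo φ F ε ∧
      ∀ g ∈ F, g ≠ 1 → normHamming 1 (φ g) > 1 - ε

/-- Sofic actions of a group `G` on a set `X`. -/
def IsSoficAction (G X : Type*) [Group G] [MulAction G X] : Prop :=
  ∀ (F : Finset G) (E : Finset X) (ε : ℝ), 0 < ε →
    ∃ (A : Type) (_ : Fintype A) (_ : DecidableEq A) (φ : G → Equiv.Perm A),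
      φ 1 = 1 ∧ IsMultiplicativeUpTo φ F ε ∧ IsOrbitApprox φ F E ε

open scoped Pointwise symmDiff in
/-- Amenability of a discrete group, through Følner sets: for every finite `K ⊆ G` and `ε > 0`
there is a nonempty finite `T ⊆ G` with `|gT ∆ T| < ε|T|` for all `g ∈ K`. -/
def IsAmenable (G : Type*) [Group G] : Prop :=
  ∀ (K : Finset G) (ε : ℝ), 0 < ε →
    ∃ T : Finset G, T.Nonempty ∧
      ∀ g ∈ K, (((g • (T : Set G)) ∆ (T : Set G)).ncard : ℝ) < ε * (T.card : ℝ)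

/-- The free product of copies `G_x`, `x ∈ X`, of `G`, amalgamated over the subgroup `A`. -/
abbrev AmalgPower {G : Type*} [Group G] (A : Subgroup G) (X : Type*) : Type _ :=
  Monoid.PushoutI (fun _ : X => A.subtype)

/-- The canonical homomorphism of `G` onto the copy `G_x` in the amalgamated free product. -/
abbrev AmalgPower.of {G : Type*} [Group G] (A : Subgroup G) {X : Type*} (x : X) :
    G →* AmalgPower A X :=
  Monoid.PushoutI.of (G := fun _ : X => G) (φ := fun _ : X => A.subtype) x

/-- The canonical homomorphism of `A` to the amalgamated free product. -/
abbrev AmalgPower.base {G : Type*} [Group G] (A : Subgroup G) (X : Type*) :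
    A →* AmalgPower A X :=
  Monoid.PushoutI.base (G := fun _ : X => G) (fun _ : X => A.subtype)

/-- The homomorphism of amalgamated free products which carries the copy `G_x` identically onto the
copy `G_{f x}` and is the identity on `A`. -/
def AmalgPower.map {G : Type*} [Group G] (A : Subgroup G) {X Y : Type*} (f : X → Y) :
    AmalgPower A X →* AmalgPower A Y :=
  Monoid.PushoutI.lift (G := fun _ : X => G) (φ := fun _ : X => A.subtype)
    (fun x => AmalgPower.of A (f x)) (AmalgPower.base A Y)
    (fun x => Monoid.PushoutI.of_comp_eq_base (G := fun _ : Y => G)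
      (φ := fun _ : Y => A.subtype) (f x))

theorem AmalgPower.map_of {G : Type*} [Group G] (A : Subgroup G) {X Y : Type*} (f : X → Y)
    (x : X) (g : G) :
    AmalgPower.map A f (AmalgPower.of A x g) = AmalgPower.of A (f x) g :=
  Monoid.PushoutI.lift_of (G := fun _ : X => G) (φ := fun _ : X => A.subtype) _ _ _ g

theorem AmalgPower.map_base {G : Type*} [Group G] (A : Subgroup G) {X Y : Type*} (f : X → Y)
    (a : A) :
    AmalgPower.map A f (AmalgPower.base A X a) = AmalgPower.base A Y a :=
  Monoid.PushoutI.lift_base (G := fun _ : X => G) (φ := fun _ : X => A.subtype) _ _ _ a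

theorem AmalgPower.map_id {G : Type*} [Group G] (A : Subgroup G) (X : Type*) :
    AmalgPower.map A (id : X → X) = MonoidHom.id _ := by
  refine Monoid.PushoutI.hom_ext (fun x => ?_) ?_
  · ext g; exact AmalgPower.map_of A id x g
  · ext a; exact AmalgPower.map_base A id a

theorem AmalgPower.map_comp {G : Type*} [Group G] (A : Subgroup G) {X Y Z : Type*}
    (f : X → Y) (k : Y → Z) :
    (AmalgPower.map A k).comp (AmalgPower.map A f) = AmalgPower.map A (k ∘ f) := by
  refine Monoid.PushoutI.hom_ext (fun x => ?_) ?_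
  · ext g; simp [AmalgPower.map_of]
  · ext a; simp [AmalgPower.map_base]

/-- The action of `H` on the amalgamated free product of the copies `G_x`, `x ∈ X`, by automorphisms
which permute the copies according to the action of `H` on `X`. -/
def AmalgPower.permAut {G : Type*} [Group G] (A : Subgroup G) (H X : Type*) [Group H]
    [MulAction H X] : H →* MulAut (AmalgPower A X) where
  toFun h := MonoidHom.toMulEquiv (AmalgPower.map A (fun x : X => h • x))
    (AmalgPower.map A (fun x : X => h⁻¹ • x))
    (by
      rw [AmalgPower.map_comp, ← AmalgPower.map_id]
      congr 1; funext x; simp)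
    (by
      rw [AmalgPower.map_comp, ← AmalgPower.map_id]
      congr 1; funext x; simp)
  map_one' := by
    ext w
    have : (fun x : X => (1 : H) • x) = id := by funext x; simp
    change AmalgPower.map A (fun x : X => (1 : H) • x) w = w
    rw [this, AmalgPower.map_id]; rfl
  map_mul' h k := by
    ext w
    have : (fun x : X => (h * k) • x) = (fun x : X => h • x) ∘ (fun x : X => k • x) := by
      funext x; simp [mul_smul]
    change AmalgPower.map A (fun x : X => (h * k) • x) w = _
    rw [this, ← AmalgPower.map_comp]; rfl

/-- The amalgamated free generalized wreath product `(∗_A^{x ∈ X} G_x) ⋊ H`. For the trivial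
subgroup `A` this is the free generalized wreath product. -/
abbrev AmalgFreeWreath {G : Type*} [Group G] (A : Subgroup G) (H X : Type*) [Group H]
    [MulAction H X] : Type _ :=
  AmalgPower A X ⋊[AmalgPower.permAut A H X] H

/-! Everything reduces to one criterion, `IsSofic.semidirectProduct`. Take a finite model of `H`
with points `a` and approximately equivariant injections `π a` of `X` into a fixed set, and a model
`ψ` of a sofic group `M` with points `b`. Then `(w, h)` acts by the skew product `(a, b) ↦ (h a, ψ
(J (π (h a)) w) b)`: equivariance of `π` makes this multiplicative, and injectivity of `π a` makes
it free.

For part 1, `M` is the amalgamated power over `ℕ` and `J` relabels the copies of `G`. Parts 2 and 3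
follow from part 1 once amalgamated powers over an amenable `A` are sofic (`IsSofic.amalgPower`).
For this, `AmalgPower.toFreeWreath` embeds the power in `FreeGroup (Σ _ : I, G ⧸ A) ⋊ G`; reduced
words give injectivity. The criterion applies again, now with `M` a free group, which is sofic by
residual finiteness.

The remaining input is that the action on cosets is sofic (`IsSofic.isSoficAction_cosets`). A coset
should be labelled by an `A`-orbit in a model of `G`. Such orbits are not available, so a Følner
piece replaces the orbit, and its first point in a random enumeration is the label. Almost invariant
pieces usually have the same first point. -/

/-- The proportion of the points of a finite set which have the property `P`. -/
noncomputable def density {A : Type*} [Fintype A] (P : A → Prop) : ℝ :=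
  (Nat.card {a // P a} : ℝ) / (Fintype.card A : ℝ)

/-! ### Counting densities on finite sets -/

section Density

variable {A B ι : Type*} [Fintype A] [Fintype B]

theorem density_nonneg (P : A → Prop) : 0 ≤ density P := by
  unfold density; positivity

theorem density_le_of_card_le {P : A → Prop} {Q : B → Prop} (e : A ≃ B)
    (h : ∀ a, P a → Q (e a)) : density P ≤ density Q := by
  unfold density
  rw [Fintype.card_congr e]
  gcongr
  exact Nat.card_le_card_of_injective (fun a : {a // P a} => (⟨e a, h a a.2⟩ : {b // Q b}))
    fun a b hab => Subtype.ext (e.injective (congrArg Subtype.val hab))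

theorem density_mono {P Q : A → Prop} (h : ∀ a, P a → Q a) : density P ≤ density Q :=
  density_le_of_card_le (Equiv.refl A) h

theorem density_comp_equiv (e : A ≃ B) (P : B → Prop) :
    density (fun a => P (e a)) = density P :=
  le_antisymm (density_le_of_card_le e fun _ => id)
    (density_le_of_card_le e.symm fun b hb => by simpa using hb)

theorem density_false : density (fun _ : A => False) = 0 := by
  simp [density]

theorem density_or_le (P Q : A → Prop) :
    density (fun a => P a ∨ Q a) ≤ density P + density Q := by
  classical
  unfold density
  rw [← add_div]
  gcongr
  simp only [Nat.card_eq_fintype_card]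
  exact_mod_cast Fintype.card_subtype_or P Q

theorem density_exists_le (s : Finset ι) (P : ι → A → Prop) {δ : ℝ}
    (h : ∀ i ∈ s, density (P i) ≤ δ) :
    density (fun a => ∃ i ∈ s, P i a) ≤ s.card * δ := by
  classical
  induction s using Finset.induction_on with
  | empty => simp [density_false]
  | insert i s his ih =>
    have h₁ := h i (Finset.mem_insert_self i s)
    have h₂ := ih fun j hj => h j (Finset.mem_insert_of_mem hj)
    have h₃ := density_or_le (P i) fun a => ∃ j ∈ s, P j a
    simp only [Finset.exists_mem_insert]
    rw [Finset.card_insert_of_notMem his]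
    push_cast
    linarith

theorem density_not [Nonempty A] (P : A → Prop) : density (fun a => ¬ P a) = 1 - density P := by
  classical
  have hA : (Fintype.card A : ℝ) ≠ 0 := by exact_mod_cast Fintype.card_ne_zero
  unfold density
  rw [eq_sub_iff_add_eq, ← add_div, div_eq_one_iff_eq hA]
  simp only [Nat.card_eq_fintype_card]
  exact_mod_cast (Fintype.card_subtype_compl P ▸
    Nat.sub_add_cancel (Fintype.card_subtype_le P))

theorem density_prod_le (P : A × B → Prop) {δ : ℝ} (hδ : 0 ≤ δ)
    (h : ∀ a, density (fun b => P (a, b)) ≤ δ) : density P ≤ δ := by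
  classical
  unfold density at *
  rcases isEmpty_or_nonempty A with hA | hA
  · simpa using hδ
  rcases isEmpty_or_nonempty B with hB | hB
  · simpa using hδ
  have hA' : 0 < (Fintype.card A : ℝ) := by exact_mod_cast Fintype.card_pos
  have hB' : 0 < (Fintype.card B : ℝ) := by exact_mod_cast Fintype.card_pos
  have e : {p // P p} ≃ Σ a, {b // P (a, b)} :=
    { toFun := fun p => ⟨p.1.1, p.1.2, p.2⟩
      invFun := fun s => ⟨(s.1, s.2.1), s.2.2⟩
      left_inv := fun _ => rfl
      right_inv := fun _ => rfl }
  rw [Nat.card_congr e, Nat.card_sigma, Fintype.card_prod, div_le_iff₀ (by positivity)]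
  push_cast
  calc ∑ a, (Nat.card {b // P (a, b)} : ℝ) ≤ ∑ _a : A, δ * Fintype.card B := by
        gcongr with a
        exact (div_le_iff₀ hB').1 (h a)
    _ = δ * (Fintype.card A * Fintype.card B) := by simp; ring

theorem density_snd_le (P : B → Prop) : density (fun p : A × B => P p.2) ≤ density P :=
  density_prod_le _ (density_nonneg P) fun _ => le_rfl

theorem density_fst_le (P : A → Prop) : density (fun p : A × B => P p.1) ≤ density P :=
  (density_comp_equiv (Equiv.prodComm A B) fun p : B × A => P p.2).trans_le (density_snd_le P)

end Density

/-! ### Soficity in terms of good points -/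

theorem normHamming_eq_density {A : Type*} [Fintype A] [DecidableEq A] (σ τ : Equiv.Perm A) :
    normHamming σ τ = density fun a => σ a ≠ τ a := by
  simp only [normHamming, density, hammingDist, Nat.card_eq_fintype_card, Fintype.card_subtype]

/-- At the point `a`, the map `φ` is multiplicative on `F`, and no nontrivial element of `F` fixes
`a`. -/
def IsGoodAt {G A : Type*} [Group G] (φ : G → Equiv.Perm A) (F : Finset G) (a : A) : Prop :=
  (∀ g ∈ F, ∀ h ∈ F, φ (g * h) a = φ g (φ h a)) ∧ ∀ g ∈ F, g ≠ 1 → φ g a ≠ a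

/-- A union bound over the pairs and elements of `F` turns the separate Hamming estimates into one
statement about most points. -/
theorem IsSofic.exists_model {G : Type*} [Group G] (hG : IsSofic G) (F : Finset G) {ε : ℝ}
    (hε : 0 < ε) :
    ∃ (A : Type) (_ : Fintype A) (_ : Nonempty A) (φ : G → Equiv.Perm A), φ 1 = 1 ∧
      density (fun a => ¬ IsGoodAt φ F a) < ε := by
  classical
  -- The bound `1 / 2` handles the empty model: there all distances are `0`, so `F` has no
  -- nontrivial element and a one-point model works.
  set δ : ℝ := min (1 / 2) (ε / (2 * (((F ×ˢ F).card : ℝ) + F.card + 1))) with hδ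
  have hδ0 : 0 < δ := by positivity
  obtain ⟨A, _, _, φ, h1, hm, hf⟩ := hG F δ hδ0
  rcases isEmpty_or_nonempty A with hA | hA
  · have hF : ∀ g ∈ F, g = 1 := by
      intro g hg
      by_contra hne
      have := hf g hg hne
      have h2 : δ ≤ 1 / 2 := min_le_left _ _
      simp [normHamming] at this
      linarith
    refine ⟨Unit, inferInstance, inferInstance, fun _ => 1, rfl, ?_⟩
    have : ∀ a : Unit, ¬ IsGoodAt (fun _ : G => (1 : Equiv.Perm Unit)) F a → False :=
      fun a h => h ⟨fun _ _ _ _ => rfl, fun g hg hne => absurd (hF g hg) hne⟩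
    exact (density_mono this).trans_lt (by rwa [density_false])
  refine ⟨A, inferInstance, hA, φ, h1, ?_⟩
  have hle : density (fun a => ¬ IsGoodAt φ F a) ≤
      density (fun a => (∃ p ∈ F ×ˢ F, φ (p.1 * p.2) a ≠ (φ p.1 * φ p.2) a) ∨
        ∃ g ∈ F, g ≠ 1 ∧ φ g a = a) := by
    refine density_mono fun a ha => ?_
    by_contra hcon
    push Not at hcon
    exact ha ⟨fun g hg h hh => hcon.1 (g, h) (Finset.mk_mem_product hg hh), hcon.2⟩
  have hmul : density (fun a => ∃ p ∈ F ×ˢ F, φ (p.1 * p.2) a ≠ (φ p.1 * φ p.2) a) ≤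
      (F ×ˢ F).card * δ := by
    refine density_exists_le _ (fun (p : G × G) a => φ (p.1 * p.2) a ≠ (φ p.1 * φ p.2) a)
      fun p hp => ?_
    rw [Finset.mem_product] at hp
    rw [← normHamming_eq_density]
    exact (hm _ hp.1 _ hp.2).le
  have hfree : density (fun a => ∃ g ∈ F, g ≠ 1 ∧ φ g a = a) ≤ F.card * δ := by
    refine density_exists_le _ (fun (g : G) a => g ≠ 1 ∧ φ g a = a) fun g hg => ?_
    by_cases hg1 : g = 1
    · simpa [hg1, density_false] using hδ0.le
    · have h2 := hf g hg hg1
      rw [normHamming_eq_density] at h2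
      have h3 := density_not (fun a => (1 : Equiv.Perm A) a ≠ φ g a)
      have h4 : density (fun a => g ≠ 1 ∧ φ g a = a) ≤
          density (fun a => ¬ (1 : Equiv.Perm A) a ≠ φ g a) :=
        density_mono fun a ha => by simp [ha.2]
      linarith
  have h5 := density_or_le (fun a => ∃ p ∈ F ×ˢ F, φ (p.1 * p.2) a ≠ (φ p.1 * φ p.2) a)
    (fun a => ∃ g ∈ F, g ≠ 1 ∧ φ g a = a)
  have h6 : δ ≤ ε / (2 * (((F ×ˢ F).card : ℝ) + F.card + 1)) := min_le_right _ _
  rw [le_div_iff₀ (by positivity)] at h6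
  nlinarith

theorem isSofic_of_exists_model {G : Type*} [Group G]
    (h : ∀ (F : Finset G) (ε : ℝ), 0 < ε →
      ∃ (A : Type) (_ : Fintype A) (_ : Nonempty A) (φ : G → Equiv.Perm A), φ 1 = 1 ∧
        density (fun a => ¬ IsGoodAt φ F a) < ε) : IsSofic G := by
  classical
  intro F ε hε
  obtain ⟨A, _, _, φ, h1, hd⟩ := h F ε hε
  refine ⟨A, inferInstance, inferInstance, φ, h1, fun g hg k hk => ?_, fun g hg hne => ?_⟩
  · rw [normHamming_eq_density]
    exact (density_mono fun a ha hgood => ha (hgood.1 g hg k hk)).trans_lt hd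
  · rw [normHamming_eq_density]
    have h3 := density_not (fun a => (1 : Equiv.Perm A) a ≠ φ g a)
    have h4 : density (fun a => ¬ (1 : Equiv.Perm A) a ≠ φ g a) ≤
        density (fun a => ¬ IsGoodAt φ F a) :=
      density_mono fun a ha hgood => hgood.2 g hg hne (by simpa using Eq.symm (not_not.1 ha))
    linarith

theorem IsSofic.of_injective {G K : Type*} [Group G] [Group K] (hK : IsSofic K) (f : G →* K)
    (hf : Function.Injective f) : IsSofic G := by
  classical
  refine isSofic_of_exists_model fun F ε hε => ?_
  obtain ⟨A, i₁, i₂, φ, h1, hd⟩ := hK.exists_model (F.image f) hε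
  refine ⟨A, i₁, i₂, φ ∘ f, by simp [h1], (density_mono fun a ha hgood => ha ⟨?_, ?_⟩).trans_lt hd⟩
  · intro g hg h hh
    simpa using hgood.1 _ (Finset.mem_image_of_mem f hg) _ (Finset.mem_image_of_mem f hh)
  · intro g hg hne
    exact hgood.2 _ (Finset.mem_image_of_mem f hg) ((map_ne_one_iff f hf).2 hne)

/-- A group in which finite sets can be separated from `1` by homomorphisms to finite groups is
sofic. -/
theorem isSofic_of_exists_finite_quotient {G : Type*} [Group G]
    (h : ∀ F : Finset G, ∃ (Q : Type*) (_ : Group Q) (_ : Finite Q) (f : G →* Q),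
      ∀ g ∈ F, g ≠ 1 → f g ≠ 1) : IsSofic G := by
  refine isSofic_of_exists_model fun F ε hε => ?_
  obtain ⟨Q, _, _, f, hf⟩ := h F
  obtain ⟨n, ⟨e⟩⟩ := Finite.exists_equiv_fin Q
  let ψ : G →* Equiv.Perm (Fin n) :=
    (Equiv.permCongrHom e).toMonoidHom.comp ((MulAction.toPermHom Q Q).comp f)
  have : ∀ a, ¬ IsGoodAt ψ F a → False := by
    refine fun a ha => ha ⟨fun g _ k _ => by rw [map_mul]; rfl, fun g hg hne hfix => ?_⟩
    have h1 : e (f g * e.symm a) = a := hfix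
    rw [← e.eq_symm_apply, mul_eq_right] at h1
    exact hf g hg hne h1
  exact ⟨Fin n, inferInstance, ⟨e 1⟩, ψ, map_one ψ,
    (density_mono this).trans_lt (by rwa [density_false])⟩

/-- A sofic action need not come with free models, so a model of `H` is multiplied by a model of the
action. Equivariance is recorded at `φ h a` because the product of two elements of the skew product
is evaluated there. -/
theorem IsSofic.exists_action_model {H X : Type*} [Group H] [MulAction H X] (hH : IsSofic H)
    (hα : IsSoficAction H X) (F : Finset H) (E : Finset X) {ε : ℝ} (hε : 0 < ε) :
    ∃ (A : Type) (_ : Fintype A) (_ : Nonempty A) (φ : H → Equiv.Perm A) (π : A → X → ℕ ⊕ X),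
      φ 1 = 1 ∧ (∀ a, Function.Injective (π a)) ∧
      density (fun a => ¬ (IsGoodAt φ F a ∧ ∀ g ∈ F, ∀ h ∈ F, ∀ x ∈ E,
        π (φ g (φ h a)) (g • x) = π (φ h a) x)) < ε := by
  classical
  obtain ⟨A₁, _, _, φ₁, h₁, hd₁⟩ := hH.exists_model F (half_pos hε)
  -- Each pair in `F ×ˢ F` excludes three events: failure of multiplicativity, and either of two
  -- points leaving `S`.
  set δ : ℝ := ε / (2 * ((F ×ˢ F).card * 3 + 1)) with hδ
  have hδ0 : 0 < δ := by positivity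
  set E' : Finset X := E ∪ (F ×ˢ E).image (fun p => p.1 • p.2) with hE'
  obtain ⟨A₂, _, _, φ₂, h₂, hm, C, _, S, κ, hS, hκ⟩ := hα F E' δ hδ0
  obtain ⟨n, ⟨e⟩⟩ := Finite.exists_equiv_fin C
  have hA₂ : Nonempty A₂ := by
    by_contra hcon
    rw [not_nonempty_iff] at hcon
    simp [Finset.eq_empty_of_isEmpty S] at hS
  have hSd : density (fun a => a ∉ S) < δ := by
    rw [density_not]
    have : density (fun a => a ∈ S) = (S.card : ℝ) / Fintype.card A₂ := by
      simp [density]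
    rw [this]
    have hpos : 0 < (Fintype.card A₂ : ℝ) := by exact_mod_cast Fintype.card_pos
    have := (lt_div_iff₀ hpos).2 hS
    linarith
  let φ : H → Equiv.Perm (A₁ × A₂) := fun h => (φ₁ h).prodCongr (φ₂ h)
  -- Where `κ` is undefined the value is `x` itself in the other summand, so `π a` is injective at
  -- every point.
  let π : A₁ × A₂ → X → ℕ ⊕ X := fun a x =>
    if h : a.2 ∈ S ∧ x ∈ E' then .inl (e (κ ⟨a.2, h.1⟩ ⟨x, h.2⟩)) else .inr x
  refine ⟨A₁ × A₂, inferInstance, inferInstance, φ, π, ?_, ?_, ?_⟩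
  · ext a <;> simp [φ, h₁, h₂]
  · intro a x y hxy
    simp only [π] at hxy
    split_ifs at hxy with hx hy hy
    · simpa [Fin.val_inj] using hxy
    · exact Sum.inr_injective hxy
  · let bad : H × H → A₂ → Prop := fun p a =>
      φ₂ (p.1 * p.2) a ≠ (φ₂ p.1 * φ₂ p.2) a ∨ (φ₂ p.2 a ∉ S ∨ (φ₂ p.1 * φ₂ p.2) a ∉ S)
    have hbad : ∀ p ∈ F ×ˢ F, density (bad p) ≤ 3 * δ := by
      intro p hp
      rw [Finset.mem_product] at hp
      have e₁ := hm _ hp.1 _ hp.2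
      rw [normHamming_eq_density] at e₁
      have e₂ := density_comp_equiv (φ₂ p.2) (fun a => a ∉ S)
      have e₃ := density_comp_equiv (φ₂ p.1 * φ₂ p.2) (fun a => a ∉ S)
      have e₄ := density_or_le (fun a => φ₂ p.2 a ∉ S) (fun a => (φ₂ p.1 * φ₂ p.2) a ∉ S)
      have e₅ := density_or_le (fun a => φ₂ (p.1 * p.2) a ≠ (φ₂ p.1 * φ₂ p.2) a)
        (fun a => φ₂ p.2 a ∉ S ∨ (φ₂ p.1 * φ₂ p.2) a ∉ S)
      simp only [bad]
      linarith
    have hex := density_exists_le (F ×ˢ F) bad hbad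
    have hfst := density_fst_le (B := A₂) fun a => ¬ IsGoodAt φ₁ F a
    have hsnd := density_snd_le (A := A₁) fun a => ∃ p ∈ F ×ˢ F, bad p a
    have hor := density_or_le (fun a : A₁ × A₂ => ¬ IsGoodAt φ₁ F a.1)
      (fun a : A₁ × A₂ => ∃ p ∈ F ×ˢ F, bad p a.2)
    have hle : density (fun a => ¬ (IsGoodAt φ F a ∧ ∀ g ∈ F, ∀ h ∈ F, ∀ x ∈ E,
        π (φ g (φ h a)) (g • x) = π (φ h a) x)) ≤
        density (fun a : A₁ × A₂ => ¬ IsGoodAt φ₁ F a.1 ∨ ∃ p ∈ F ×ˢ F, bad p a.2) := by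
      refine density_mono fun a ha => ?_
      by_contra hcon
      push Not at hcon
      obtain ⟨hg, hb⟩ := hcon
      refine ha ⟨⟨fun g hgF h hhF => ?_, fun g hgF hne hfix => ?_⟩, fun g hgF h hhF x hx => ?_⟩
      · have := hb (g, h) (Finset.mk_mem_product hgF hhF)
        simp only [bad, not_or, not_not] at this
        exact Prod.ext (hg.1 g hgF h hhF) this.1
      · exact hg.2 g hgF hne (congrArg Prod.fst hfix)
      · have := hb (g, h) (Finset.mk_mem_product hgF hhF)
        simp only [bad, not_or, not_not] at this
        have hx' : x ∈ E' := Finset.mem_union_left _ hx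
        have hgx : g • x ∈ E' := Finset.mem_union_right _
          (Finset.mem_image_of_mem (fun p : H × X => p.1 • p.2) (Finset.mk_mem_product hgF hx))
        have hs := hκ (φ₂ h a.2) this.2.1 g hgF (g • x) hgx this.2.2 (by simpa using hx')
        simp only [π, φ, Equiv.prodCongr_apply, Prod.map_snd]
        rw [dif_pos ⟨this.2.2, hgx⟩, dif_pos ⟨this.2.1, hx'⟩, hs]
        simp
    have hfin : ((F ×ˢ F).card : ℝ) * (3 * δ) < ε / 2 := by
      have : δ * (2 * ((F ×ˢ F).card * 3 + 1)) = ε := by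
        rw [hδ]; field_simp
      nlinarith
    linarith

/-! ### Semidirect products by skew products -/

/-- Let `N` be a group with an action of `H` by automorphisms and with homomorphisms `J f` to a
sofic group, indexed by the maps `f` from `X`, which depend on `f` in a finitary and equivariant way.
If `H` is sofic with a sofic action on `X`, then `N ⋊ H` is sofic. -/
theorem IsSofic.semidirectProduct {H X N M : Type*} [Group H] [MulAction H X] [Group N] [Group M]
    (hH : IsSofic H) (hα : IsSoficAction H X) (hM : IsSofic M) (θ : H →* MulAut N)
    (J : (X → ℕ ⊕ X) → N →* M)
    (hinj : ∀ f, Function.Injective f → Function.Injective (J f))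
    (hsupp : ∀ w, ∃ E : Finset X, ∀ f f', (∀ x ∈ E, f x = f' x) → J f w = J f' w)
    (hequiv : ∀ f h w, J f (θ h w) = J (fun x => f (h • x)) w) :
    IsSofic (N ⋊[θ] H) := by
  classical
  refine isSofic_of_exists_model fun F ε hε => ?_
  choose E hE using hsupp
  set F' : Finset H := F.image fun p => p.right
  set W : Finset N := F.image fun p => p.left
  obtain ⟨A, _, _, φ, π, h1, hπ, hd⟩ :=
    hH.exists_action_model hα F' (W.biUnion E) (half_pos hε)
  obtain ⟨B, _, _, ψ, hψ1, hψd⟩ := hM.exists_model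
    ((Finset.univ ×ˢ W).image fun p : A × N => J (π p.1) p.2) (half_pos hε)
  set D := (Finset.univ ×ˢ W).image fun p : A × N => J (π p.1) p.2 with hD
  have hmem : ∀ a, ∀ w ∈ W, J (π a) w ∈ D := fun a w hw =>
    Finset.mem_image_of_mem (fun p : A × N => J (π p.1) p.2)
      (Finset.mk_mem_product (Finset.mem_univ a) hw)
  -- The index of `J` is taken at the target point `φ p.right a`, so that `hequiv` and equivariance
  -- of `π` turn `θ p.right q.left` there into `q.left` at the previous point.
  let Φ : N ⋊[θ] H → Equiv.Perm (A × B) := fun p =>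
    Equiv.prodShear (φ p.right) fun a => ψ (J (π (φ p.right a)) p.left)
  refine ⟨A × B, inferInstance, inferInstance, Φ, ?_, ?_⟩
  · ext a <;> simp [Φ, h1, hψ1]
  set good : A → Prop := fun a => IsGoodAt φ F' a ∧ ∀ g ∈ F', ∀ h ∈ F', ∀ x ∈ W.biUnion E,
        π (φ g (φ h a)) (g • x) = π (φ h a) x with hgood
  have hfst := density_fst_le (B := B) fun a => ¬ good a
  have hsnd := density_snd_le (A := A) fun b => ¬ IsGoodAt ψ D b
  have hor := density_or_le (fun a : A × B => ¬ good a.1) (fun a : A × B => ¬ IsGoodAt ψ D a.2)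
  refine (density_mono fun a ha => ?_).trans_lt (lt_of_le_of_lt hor (by linarith))
  by_contra hcon
  push Not at hcon
  obtain ⟨⟨hg₁, hg₂⟩, hb⟩ := hcon
  have hF' : ∀ p ∈ F, p.right ∈ F' := fun p hp => Finset.mem_image_of_mem _ hp
  have hW : ∀ p ∈ F, p.left ∈ W := fun p hp => Finset.mem_image_of_mem _ hp
  refine ha ⟨fun p hp q hq => ?_, fun p hp hne hfix => ?_⟩
  · have hmul := hg₁.1 _ (hF' p hp) _ (hF' q hq)
    refine Prod.ext hmul ?_
    have hJ : J (π (φ p.right (φ q.right a.1))) (θ p.right q.left) =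
        J (π (φ q.right a.1)) q.left := by
      rw [hequiv]
      refine hE _ _ _ fun x hx => ?_
      exact hg₂ _ (hF' p hp) _ (hF' q hq) x (Finset.mem_biUnion.2 ⟨_, hW q hq, hx⟩)
    simp only [Φ, Equiv.prodShear_apply, SemidirectProduct.mul_right, SemidirectProduct.mul_left,
      hmul, map_mul, hJ]
    exact hb.1 _ (hmem _ _ (hW p hp)) _ (hmem _ _ (hW q hq))
  · have hfix₁ : φ p.right a.1 = a.1 := congrArg Prod.fst hfix
    have hfix₂ : ψ (J (π (φ p.right a.1)) p.left) a.2 = a.2 := congrArg Prod.snd hfix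
    by_cases hr : p.right = 1
    · refine hb.2 _ (hmem _ _ (hW p hp)) ?_ hfix₂
      exact (map_ne_one_iff _ (hinj _ (hπ _))).2 fun hl => hne (SemidirectProduct.ext hl hr)
    · exact hg₁.2 _ (hF' p hp) hr hfix₁

/-! ### Relabelling the copies in an amalgamated power -/

theorem AmalgPower.map_injective {G : Type*} [Group G] (A : Subgroup G) {X Y : Type*} {f : X → Y}
    (hf : Function.Injective f) : Function.Injective (AmalgPower.map A f) := by
  rcases isEmpty_or_nonempty X with hX | hX
  -- With no copies there may be no left inverse of `f`, but the group is then just the image of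
  -- `A`.
  · have hsurj : ∀ w : AmalgPower A X, ∃ a, AmalgPower.base A X a = w := by
      intro w
      induction w using Monoid.PushoutI.induction_on with
      | of i g => exact isEmptyElim i
      | base a => exact ⟨a, rfl⟩
      | mul x y hx hy =>
        obtain ⟨a, rfl⟩ := hx
        obtain ⟨b, rfl⟩ := hy
        exact ⟨a * b, map_mul _ _ _⟩
    intro w w' h
    obtain ⟨a, rfl⟩ := hsurj w
    obtain ⟨b, rfl⟩ := hsurj w'
    rw [AmalgPower.map_base, AmalgPower.map_base] at h
    rw [Monoid.PushoutI.base_injective (fun _ => A.subtype_injective) h]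
  · obtain ⟨k, hk⟩ := hf.hasLeftInverse
    refine Function.LeftInverse.injective (g := AmalgPower.map A k) fun w => ?_
    rw [← MonoidHom.comp_apply, AmalgPower.map_comp, hk.id, AmalgPower.map_id, MonoidHom.id_apply]

theorem AmalgPower.exists_finset_map_eq {G : Type*} [Group G] (A : Subgroup G) {X : Type*}
    (w : AmalgPower A X) : ∃ E : Finset X, ∀ {Y : Type*} (f f' : X → Y), (∀ x ∈ E, f x = f' x) →
      AmalgPower.map A f w = AmalgPower.map A f' w := by
  classical
  induction w using Monoid.PushoutI.induction_on with
  | of i g =>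
    refine ⟨{i}, fun f f' h => ?_⟩
    have h₁ := AmalgPower.map_of A f i g
    have h₂ := AmalgPower.map_of A f' i g
    rw [h i (Finset.mem_singleton_self i)] at h₁
    exact h₁.trans h₂.symm
  | base a =>
    exact ⟨∅, fun f f' _ => (AmalgPower.map_base A f a).trans (AmalgPower.map_base A f' a).symm⟩
  | mul x y hx hy =>
    obtain ⟨E, hE⟩ := hx
    obtain ⟨E', hE'⟩ := hy
    refine ⟨E ∪ E', fun f f' h => ?_⟩
    rw [map_mul, map_mul, hE f f' fun x hx => h x (Finset.mem_union_left _ hx),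
      hE' f f' fun x hx => h x (Finset.mem_union_right _ hx)]

theorem isSofic_amalgFreeWreath {G H X : Type*} [Group G] [Group H] [Countable X] [MulAction H X]
    (hH : IsSofic H) (hα : IsSoficAction H X) (A : Subgroup G)
    (hA : ∀ (I : Type) [Countable I], IsSofic (AmalgPower A I)) :
    IsSofic (AmalgFreeWreath A H X) := by
  obtain ⟨e, he⟩ := exists_injective_nat (ℕ ⊕ X)
  refine hH.semidirectProduct hα (hA ℕ) (AmalgPower.permAut A H X)
    (fun f => AmalgPower.map A (e ∘ f)) (fun f hf => AmalgPower.map_injective A (he.comp hf))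
    (fun w => ?_) (fun f h w => ?_)
  · obtain ⟨E, hE⟩ := AmalgPower.exists_finset_map_eq A w
    exact ⟨E, fun f f' h => hE _ _ fun x hx => congrArg e (h x hx)⟩
  · exact DFunLike.congr_fun (AmalgPower.map_comp A (fun x : X => h • x) (e ∘ f)) w

/-! ### Free groups: permutation action and residual finiteness -/

/-- The action of a group on a free group which permutes the free generators. -/
def FreeGroup.permAut (H X : Type*) [Group H] [MulAction H X] : H →* MulAut (FreeGroup X) where
  toFun h := FreeGroup.freeGroupCongr (MulAction.toPerm h)
  map_one' := by
    ext w
    have : ⇑(MulAction.toPerm (1 : H) : Equiv.Perm X) = id := by funext x; simp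
    simp [this]
  map_mul' h k := by
    ext w
    have : ⇑(MulAction.toPerm (h * k) : Equiv.Perm X) = fun x => h • k • x := by
      funext x; simp [mul_smul]
    simp only [FreeGroup.freeGroupCongr_apply, MulAut.mul_apply, this]
    exact (FreeGroup.map.comp (fun x : X => k • x) (fun x : X => h • x) w).symm

theorem FreeGroup.permAut_apply_of {H X : Type*} [Group H] [MulAction H X] (h : H) (x : X) :
    FreeGroup.permAut H X h (FreeGroup.of x) = FreeGroup.of (h • x) := by
  simp [FreeGroup.permAut]

theorem FreeGroup.exists_finset_map_eq {X : Type*} (w : FreeGroup X) :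
    ∃ E : Finset X, ∀ {Y : Type*} (f f' : X → Y), (∀ x ∈ E, f x = f' x) →
      FreeGroup.map f w = FreeGroup.map f' w := by
  classical
  induction w using FreeGroup.induction_on with
  | C1 => exact ⟨∅, fun f f' _ => by simp⟩
  | of x => exact ⟨{x}, fun f f' h => by simp [h x]⟩
  | inv_of x _ => exact ⟨{x}, fun f f' h => by simp [h x]⟩
  | mul x y hx hy =>
    obtain ⟨E, hE⟩ := hx
    obtain ⟨E', hE'⟩ := hy
    refine ⟨E ∪ E', fun f f' h => ?_⟩
    rw [_root_.map_mul, _root_.map_mul, hE f f' fun x hx => h x (Finset.mem_union_left _ hx),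
      hE' f f' fun x hx => h x (Finset.mem_union_right _ hx)]

/-- A partially defined injective map of a finite set extends to a permutation. -/
theorem exists_perm_extending {V : Type*} [Finite V] (p : V → Prop) (f : V → V)
    (hf : ∀ x y, p x → p y → f x = f y → x = y) :
    ∃ σ : Equiv.Perm V, ∀ x, p x → σ x = f x := by
  classical
  have := Fintype.ofFinite V
  let e : {x // p x} ≃ {y // y ∈ f '' {x | p x}} :=
    Equiv.Set.imageOfInjOn f {x | p x} fun x hx y hy => hf x y hx hy
  exact ⟨e.extendSubtype, fun x hx => e.extendSubtype_apply_of_mem x hx⟩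

/-- Free groups are residually finite. -/
theorem FreeGroup.exists_finite_quotient.{u} {X : Type u} (F : Finset (FreeGroup X)) :
    ∃ (Q : Type u) (_ : Group Q) (_ : Finite Q) (f : FreeGroup X →* Q),
      ∀ g ∈ F, g ≠ 1 → f g ≠ 1 := by
  classical
  -- `V` consists of the suffixes of the words in `F`. Each generator acts by a partial left
  -- multiplication on `V`, extended to a permutation; reading `w` from the right then carries `1`
  -- through its suffixes to `w`.
  let V : Set (FreeGroup X) :=
    {1} ∪ ⋃ w ∈ F, {v | ∃ L ∈ w.toWord.tails.toFinset, v = FreeGroup.mk L}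
  have hfin : V.Finite := by
    refine (Set.finite_singleton _).union (Set.Finite.biUnion F.finite_toSet fun w _ => ?_)
    refine ((w.toWord.tails.toFinset.finite_toSet).image FreeGroup.mk).subset ?_
    rintro _ ⟨L, hL, rfl⟩
    exact ⟨L, hL, rfl⟩
  have : Finite V := hfin
  have hV1 : (1 : FreeGroup X) ∈ V := Or.inl rfl
  have hσ : ∀ x : X, ∃ σ : Equiv.Perm V, ∀ v : V, FreeGroup.of x * v ∈ V →
      (σ v : FreeGroup X) = FreeGroup.of x * v := by
    intro x
    obtain ⟨σ, hσ⟩ := exists_perm_extending (fun v : V => FreeGroup.of x * v ∈ V)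
      (fun v => if h : FreeGroup.of x * v ∈ V then ⟨FreeGroup.of x * v, h⟩ else v) (by
        intro v v' h h' heq
        rw [dif_pos h, dif_pos h', Subtype.mk.injEq] at heq
        exact Subtype.ext (mul_left_cancel heq))
    exact ⟨σ, fun v h => by rw [hσ v h, dif_pos h]⟩
  choose σ hσ using hσ
  refine ⟨Equiv.Perm V, inferInstance, inferInstance, FreeGroup.lift σ, fun w hw hne h1 => ?_⟩
  have key : ∀ L, L <:+ w.toWord →
      (FreeGroup.lift σ (FreeGroup.mk L) ⟨1, hV1⟩ : FreeGroup X) = FreeGroup.mk L := by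
    intro L
    induction L with
    | nil => exact fun _ => rfl
    | cons l L ih =>
      intro hL
      have hL' := ih ((List.suffix_cons l L).trans hL)
      have hmem : FreeGroup.mk (l :: L) ∈ V :=
        Or.inr (Set.mem_iUnion₂.2 ⟨w, hw, l :: L, by simpa using hL, rfl⟩)
      obtain ⟨x, b⟩ := l
      have hmul : FreeGroup.mk ((x, b) :: L) = FreeGroup.mk [(x, b)] * FreeGroup.mk L := by
        rw [FreeGroup.mul_mk]; rfl
      set v := FreeGroup.lift σ (FreeGroup.mk L) ⟨1, hV1⟩
      cases b with
      | true =>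
        have hof : FreeGroup.mk [(x, true)] = FreeGroup.of x := rfl
        rw [hmul, hof, ← hL'] at hmem ⊢
        rw [hL', _root_.map_mul, FreeGroup.lift_apply_of, Equiv.Perm.mul_apply, hσ x v hmem, hL']
      | false =>
        have hof : FreeGroup.mk [(x, false)] = (FreeGroup.of x)⁻¹ := rfl
        rw [hmul, hof] at hmem ⊢
        have hu : σ x ⟨_, hmem⟩ = v := by
          apply Subtype.ext
          rw [hσ x ⟨_, hmem⟩ (by simp [← hL']), hL']
          exact mul_inv_cancel_left _ _
        rw [_root_.map_mul, _root_.map_inv, FreeGroup.lift_apply_of, Equiv.Perm.mul_apply,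
          Equiv.Perm.inv_eq_iff_eq.2 hu.symm]
  have hk := key w.toWord List.suffix_rfl
  rw [FreeGroup.mk_toWord, h1] at hk
  exact hne hk.symm

theorem FreeGroup.isSofic (X : Type*) : IsSofic (FreeGroup X) :=
  isSofic_of_exists_finite_quotient FreeGroup.exists_finite_quotient

theorem IsSofic.freeGroup_semidirectProduct {H X : Type*} [Group H] [MulAction H X]
    (hH : IsSofic H) (hα : IsSoficAction H X) :
    IsSofic (FreeGroup X ⋊[FreeGroup.permAut H X] H) := by
  refine hH.semidirectProduct hα (FreeGroup.isSofic (ℕ ⊕ X)) (FreeGroup.permAut H X)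
    (fun f => FreeGroup.map f) (fun f hf => ?_) (fun w => ?_) (fun f h w => ?_)
  · exact FreeGroup.map_injective hf
  · obtain ⟨E, hE⟩ := FreeGroup.exists_finset_map_eq w
    exact ⟨E, fun f f' h => hE f f' h⟩
  · exact FreeGroup.map.comp (fun x : X => h • x) f w

/-! ### First points in a random enumeration -/

/-- The least label, in the enumeration `ω`, of a point of `U`. -/
def minLabel {B : Type*} [DecidableEq B] {n : ℕ} (ω : B ≃ Fin n) (U : Finset B) :
    WithTop (Fin n) :=
  (U.image ω).min

theorem exists_mem_minLabel_eq {B : Type*} [DecidableEq B] {n : ℕ} (ω : B ≃ Fin n) {U : Finset B}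
    (hU : U.Nonempty) : ∃ u ∈ U, minLabel ω U = ω u := by
  obtain ⟨k, hk⟩ := Finset.min_of_nonempty (hU.image ω)
  obtain ⟨u, hu, rfl⟩ := Finset.mem_image.1 (Finset.mem_of_min hk)
  exact ⟨u, hu, hk⟩

theorem minLabel_eq_of_subset {B : Type*} [DecidableEq B] {n : ℕ} {ω : B ≃ Fin n} {U W : Finset B}
    {w : B} (hUW : U ⊆ W) (hw : w ∈ U) (h : minLabel ω W = ω w) : minLabel ω U = ω w := by
  refine le_antisymm (Finset.min_le (Finset.mem_image_of_mem ω hw)) ?_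
  rw [← h]
  exact Finset.min_mono (Finset.image_subset_image hUW)

open scoped symmDiff in
/-- For a uniformly random enumeration, two finite sets `U` and `V` have their first points in common
except with probability at most `|U ∆ V| / |V|`. -/
theorem density_minLabel_ne_le {B : Type*} [Fintype B] [DecidableEq B] (U V : Finset B)
    (hV : V.Nonempty) :
    density (fun ω : B ≃ Fin (Fintype.card B) => minLabel ω U ≠ minLabel ω V) ≤
      ((U ∆ V).card : ℝ) / V.card := by
  set W := U ∪ V with hW
  have hWne : W.Nonempty := hV.mono Finset.subset_union_right
  let P : B → (B ≃ Fin (Fintype.card B)) → Prop := fun w ω => minLabel ω W = ω w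
  -- Precomposing the enumeration with the transposition of `w` and `w'` preserves `W`, so all
  -- points of `W` are equally likely to come first.
  have hP : ∀ w ∈ W, ∀ w' ∈ W, density (P w) ≤ density (P w') := by
    intro w hw w' hw'
    refine density_le_of_card_le (Equiv.equivCongr (Equiv.swap w w') (Equiv.refl _)) fun ω h => ?_
    have himg : W.image (Equiv.equivCongr (Equiv.swap w w') (Equiv.refl _) ω) = W.image ω := by
      have hsw : W.image (Equiv.swap w w') = W := by
        refine Finset.eq_of_subset_of_card_le (fun u hu => ?_) ?_
        · obtain ⟨v, hv, rfl⟩ := Finset.mem_image.1 hu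
          by_cases h₁ : v = w
          · simpa [h₁] using hw'
          by_cases h₂ : v = w'
          · simpa [h₂] using hw
          rwa [Equiv.swap_apply_of_ne_of_ne h₁ h₂]
        · rw [Finset.card_image_of_injective _ (Equiv.injective _)]
      conv_rhs => rw [← hsw]
      rw [Finset.image_image]
      rfl
    change (W.image _).min = _
    rw [himg]
    simpa [P, minLabel] using h
  have hΩ : (0 : ℝ) < Fintype.card (B ≃ Fin (Fintype.card B)) := by
    have : Nonempty (B ≃ Fin (Fintype.card B)) := ⟨Fintype.equivFin B⟩
    exact_mod_cast Fintype.card_pos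
  have hsum : ∑ w ∈ W, density (P w) ≤ 1 := by
    unfold density
    rw [← Finset.sum_div, div_le_one hΩ, ← Finset.sum_coe_sort]
    have : Nat.card (Σ w : W, {ω // P w ω}) ≤ Nat.card (B ≃ Fin (Fintype.card B)) := by
      refine Nat.card_le_card_of_injective (fun s => s.2.1) ?_
      rintro ⟨⟨w, hw⟩, ω, h⟩ ⟨⟨w', hw'⟩, ω', h'⟩ heq
      obtain rfl : ω = ω' := heq
      have : w = w' := ω.injective (WithTop.coe_injective (h.symm.trans h'))
      subst this
      rfl
    rw [Nat.card_sigma, Nat.card_eq_fintype_card] at this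
    exact_mod_cast this
  have hWpos : (0 : ℝ) < W.card := by exact_mod_cast hWne.card_pos
  have hVpos : (0 : ℝ) < V.card := by exact_mod_cast hV.card_pos
  have hle : ∀ w ∈ W, density (P w) ≤ 1 / W.card := by
    intro w hw
    rw [le_div_iff₀ hWpos]
    calc density (P w) * W.card = ∑ _w' ∈ W, density (P w) := by simp [mul_comm]
      _ ≤ ∑ w' ∈ W, density (P w') := Finset.sum_le_sum fun w' hw' => hP w hw w' hw'
      _ ≤ 1 := hsum
  have hUV : U ∆ V ⊆ W := Finset.symmDiff_subset_union
  calc density (fun ω : B ≃ Fin (Fintype.card B) => minLabel ω U ≠ minLabel ω V)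
      ≤ density fun ω => ∃ w ∈ U ∆ V, P w ω := by
        -- If the first point of `U ∪ V` lies in both sets, it is first in both.
        refine density_mono fun ω hne => ?_
        obtain ⟨w, hw, h⟩ := exists_mem_minLabel_eq ω hWne
        refine ⟨w, ?_, h⟩
        by_contra hcon
        rw [Finset.mem_symmDiff] at hcon
        rw [hW, Finset.mem_union] at hw
        have hwU : w ∈ U := by tauto
        have hwV : w ∈ V := by tauto
        exact hne ((minLabel_eq_of_subset Finset.subset_union_left hwU h).trans
          (minLabel_eq_of_subset Finset.subset_union_right hwV h).symm)
    _ ≤ (U ∆ V).card * (1 / W.card) := density_exists_le _ P fun w hw => hle w (hUV hw)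
    _ ≤ (U ∆ V).card * (1 / V.card) := by
        gcongr
        exact Finset.subset_union_right
    _ = _ := by ring

-- Injectivity is needed only on `T`, to keep the denominator; collapsing in `T'` can only shrink
-- the symmetric difference.
open scoped symmDiff in
theorem density_minLabel_image_ne_le {B C : Type*} [Fintype B] [DecidableEq B] [DecidableEq C]
    (f : C → B) (T T' : Finset C) (hT : T.Nonempty) (hf : Set.InjOn f T) :
    density (fun ω : B ≃ Fin (Fintype.card B) =>
      minLabel ω (T'.image f) ≠ minLabel ω (T.image f)) ≤ ((T' ∆ T).card : ℝ) / T.card := by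
  refine (density_minLabel_ne_le _ _ (hT.image f)).trans ?_
  rw [Finset.card_image_of_injOn hf]
  gcongr
  refine (Finset.card_le_card (t := (T' ∆ T).image f) fun u hu => ?_).trans Finset.card_image_le
  simp only [Finset.mem_symmDiff, Finset.mem_image] at hu ⊢
  rcases hu with ⟨⟨t, ht, rfl⟩, h⟩ | ⟨⟨t, ht, rfl⟩, h⟩
  · exact ⟨t, .inl ⟨ht, fun h' => h ⟨t, h', rfl⟩⟩, rfl⟩
  · exact ⟨t, .inr ⟨ht, fun h' => h ⟨t, h', rfl⟩⟩, rfl⟩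

theorem IsGoodAt.eq_of_apply_eq {G B : Type*} [Group G] {ψ : G → Equiv.Perm B} {D : Finset G} {b : B}
    (hb : IsGoodAt ψ D b) (h1 : ψ 1 = 1) {p q : G} (hp : p ∈ D) (hq : q ∈ D) (hq' : q⁻¹ ∈ D)
    (hqp : q⁻¹ * p ∈ D) (h : ψ p b = ψ q b) : p = q := by
  by_contra hne
  refine hb.2 _ hqp (fun h' => hne (inv_mul_eq_one.1 h').symm) ?_
  rw [hb.1 _ hq' _ hp, h, ← hb.1 _ hq' _ hq, inv_mul_cancel, h1, Equiv.Perm.one_apply]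

/-! ### Soficity of the action on cosets -/

open scoped Pointwise symmDiff in
/-- The actions of a sofic group on the cosets of an amenable subgroup, and on a disjoint union of
copies of this set of cosets, are sofic. -/
theorem IsSofic.isSoficAction_cosets {G : Type*} [Group G] (hG : IsSofic G) {A : Subgroup G}
    (hA : IsAmenable A) (I : Type*) : IsSoficAction G (Σ _ : I, G ⧸ A) := by
  classical
  intro F E ε hε
  let r : (Σ _ : I, G ⧸ A) → G := fun x => x.2.out
  have hr : ∀ x, (r x : G ⧸ A) = x.2 := fun x => x.2.out_eq'
  have ha : ∀ (g : G) (x : Σ _ : I, G ⧸ A), (r x)⁻¹ * (g * r (g⁻¹ • x)) ∈ A := by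
    intro g x
    rw [← QuotientGroup.eq, hr]
    change x.2 = g • (r (g⁻¹ • x) : G ⧸ A)
    rw [hr]
    exact (smul_inv_smul g x.2).symm
  -- This cocycle satisfies `(r x)⁻¹ * g = a (g, x) * (r (g⁻¹ • x))⁻¹`: the two base points to be
  -- compared differ by an element of `A`, under which `T` is almost invariant.
  let a : G × (Σ _ : I, G ⧸ A) → A := fun p => ⟨_, ha p.1 p.2⟩
  set δ : ℝ := ε / (2 * ((F ×ˢ E).card + 1)) with hδ
  have hδ0 : 0 < δ := div_pos hε (mul_pos two_pos (Nat.cast_add_one_pos _))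
  obtain ⟨T, hTne, hT⟩ := hA ((F ×ˢ E).image fun p => (a p)⁻¹) δ hδ0
  have hT' : ∀ g ∈ F, ∀ x ∈ E, ((((a (g, x))⁻¹ • T) ∆ T).card : ℝ) / T.card ≤ δ := by
    intro g hg x hx
    have := hT _ (Finset.mem_image_of_mem (fun p => (a p)⁻¹) (Finset.mk_mem_product hg hx))
    rw [← Finset.coe_smul_finset, ← Finset.coe_symmDiff, Set.ncard_coe_finset] at this
    exact (div_le_iff₀ (by exact_mod_cast hTne.card_pos)).2 this.le
  set R : Finset G := E.image fun x => (r x)⁻¹ with hR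
  set T₀ : Finset G := T.image fun t : A => (t : G)⁻¹ with hT₀
  set Y : Finset G := T₀ * R with hY
  set D : Finset G := R ∪ F ∪ T₀ ∪ R * F ∪ Y ∪ Y⁻¹ ∪ Y⁻¹ * Y with hD
  obtain ⟨B, _, _, ψ, h1, hd⟩ := hG.exists_model D (half_pos hε)
  have hRD : ∀ x ∈ E, (r x)⁻¹ ∈ R := fun x hx => Finset.mem_image_of_mem (fun x => (r x)⁻¹) hx
  have hTD : ∀ t ∈ T, (t : G)⁻¹ ∈ T₀ := fun t ht =>
    Finset.mem_image_of_mem (fun t : A => (t : G)⁻¹) ht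
  have hYD : ∀ t ∈ T, ∀ x ∈ E, (t : G)⁻¹ * (r x)⁻¹ ∈ Y := fun t ht x hx =>
    Finset.mul_mem_mul (hTD t ht) (hRD x hx)
  have hsub₁ : R ⊆ D := fun g hg => by simp only [hD, Finset.mem_union, hg, true_or]
  have hsub₂ : F ⊆ D := fun g hg => by
    simp only [hD, Finset.mem_union, hg, true_or, or_true]
  have hsub₃ : T₀ ⊆ D := fun g hg => by
    simp only [hD, Finset.mem_union, hg, true_or, or_true]
  have hsub₄ : R * F ⊆ D := fun g hg => by
    simp only [hD, Finset.mem_union, hg, true_or, or_true]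
  have hsub₅ : Y ⊆ D := fun g hg => by
    simp only [hD, Finset.mem_union, hg, true_or, or_true]
  have hsub₆ : Y⁻¹ ⊆ D := fun g hg => by
    simp only [hD, Finset.mem_union, hg, true_or, or_true]
  have hsub₇ : Y⁻¹ * Y ⊆ D := fun g hg => by simp only [hD, Finset.mem_union, hg, or_true]
  have hinj : ∀ b, IsGoodAt ψ D b → ∀ p ∈ Y, ∀ q ∈ Y, ψ p b = ψ q b → p = q :=
    fun b hb p hp q hq => hb.eq_of_apply_eq h1 (hsub₅ hp) (hsub₅ hq)
      (hsub₆ (Finset.inv_mem_inv hq)) (hsub₇ (Finset.mul_mem_mul (Finset.inv_mem_inv hq) hp))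
  clear_value D Y T₀ R
  -- The Følner piece of the `A`-orbit of `b`; inverses appear so that moving `b` by `a` replaces
  -- `T` by `a⁻¹ • T`.
  let orb : B → Finset B := fun b => T.image fun t : A => ψ (t : G)⁻¹ b
  have : Nonempty (B ≃ Fin (Fintype.card B)) := ⟨Fintype.equivFin B⟩
  -- The enumeration is a coordinate of the model, fixed by `G`, so probabilities become densities.
  let φ : G → Equiv.Perm (B × (B ≃ Fin (Fintype.card B))) := fun g => (ψ g).prodCongr (Equiv.refl _)
  let ne : G × (Σ _ : I, G ⧸ A) → B → (B ≃ Fin (Fintype.card B)) → Prop := fun p b ω => p.1⁻¹ • p.2 ∈ E ∧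
    minLabel ω (orb (ψ (r p.2)⁻¹ (ψ p.1 b))) ≠ minLabel ω (orb (ψ (r (p.1⁻¹ • p.2))⁻¹ b))
  have hne : ∀ b, IsGoodAt ψ D b → ∀ p ∈ F ×ˢ E, density (ne p b) ≤ δ := by
    rintro b hb ⟨g, x⟩ hp
    obtain ⟨hg, hx⟩ := Finset.mem_product.1 hp
    by_cases hgx : g⁻¹ • x ∈ E
    · let f : A → B := fun s => ψ ((s : G)⁻¹ * (r (g⁻¹ • x))⁻¹) b
      have horb₂ : orb (ψ (r (g⁻¹ • x))⁻¹ b) = T.image f := by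
        refine Finset.image_congr fun t ht => ?_
        exact (hb.1 _ (hsub₃ (hTD t ht)) _ (hsub₁ (hRD _ hgx))).symm
      have horb₁ : orb (ψ (r x)⁻¹ (ψ g b)) = ((a (g, x))⁻¹ • T).image f := by
        rw [← Finset.image_smul, Finset.image_image]
        refine Finset.image_congr fun t ht => ?_
        simp only [Function.comp_apply, f]
        rw [← hb.1 _ (hsub₁ (hRD x hx)) _ (hsub₂ hg),
          ← hb.1 _ (hsub₃ (hTD t ht)) _ (hsub₄ (Finset.mul_mem_mul (hRD x hx) hg))]
        congr 2
        simp [a, mul_assoc]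
      have hfT : Set.InjOn f T := by
        intro s hs t ht hst
        have := hinj b hb _ (hYD s hs _ hgx) _ (hYD t ht _ hgx) hst
        exact Subtype.ext (inv_injective (mul_right_cancel this))
      refine (density_mono fun ω hω => ?_).trans
        ((density_minLabel_image_ne_le f T ((a (g, x))⁻¹ • T) hTne hfT).trans (hT' g hg x hx))
      rw [← horb₁, ← horb₂]
      exact hω.2
    · exact (density_mono (Q := fun _ => False) fun ω hω => hgx hω.1).trans
        (by rw [density_false]; exact hδ0.le)
  have hnn : 0 ≤ ((F ×ˢ E).card : ℝ) * δ := mul_nonneg (Nat.cast_nonneg _) hδ0.le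
  have hfib : density (fun s : B × (B ≃ Fin (Fintype.card B)) => IsGoodAt ψ D s.1 ∧ ∃ p ∈ F ×ˢ E, ne p s.1 s.2) ≤
      (F ×ˢ E).card * δ := by
    refine density_prod_le _ hnn fun b => ?_
    by_cases hb : IsGoodAt ψ D b
    · exact (density_mono fun ω hω => hω.2).trans
        (density_exists_le _ (fun p ω => ne p b ω) (hne b hb))
    · exact (density_mono (Q := fun _ => False) fun ω hω => hb hω.1).trans
        (by rw [density_false]; exact hnn)
  have hfst := density_fst_le (B := (B ≃ Fin (Fintype.card B))) fun b => ¬ IsGoodAt ψ D b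
  let good : B × (B ≃ Fin (Fintype.card B)) → Prop := fun s => IsGoodAt ψ D s.1 ∧ ∀ p ∈ F ×ˢ E, ¬ ne p s.1 s.2
  have hgood : density (fun s => ¬ good s) < ε := by
    have hor := density_or_le (fun s : B × (B ≃ Fin (Fintype.card B)) => ¬ IsGoodAt ψ D s.1)
      (fun s => IsGoodAt ψ D s.1 ∧ ∃ p ∈ F ×ˢ E, ne p s.1 s.2)
    have hle : density (fun s => ¬ good s) ≤ density (fun s : B × (B ≃ Fin (Fintype.card B)) => ¬ IsGoodAt ψ D s.1 ∨
        (IsGoodAt ψ D s.1 ∧ ∃ p ∈ F ×ˢ E, ne p s.1 s.2)) := by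
      refine density_mono fun s hs => ?_
      by_cases hb : IsGoodAt ψ D s.1
      · refine .inr ⟨hb, ?_⟩
        by_contra hcon
        push Not at hcon
        exact hs ⟨hb, hcon⟩
      · exact .inl hb
    have hfin : ((F ×ˢ E).card : ℝ) * δ < ε / 2 := by
      have : δ * (2 * ((F ×ˢ E).card + 1)) = ε := by
        rw [hδ]; field_simp
      nlinarith
    linarith
  let C := WithTop (Fin (Fintype.card B)) × Fin (E.image Sigma.fst).card
  let e := (E.image Sigma.fst).equivFin
  have hEmem : ∀ x : {x // x ∈ E}, x.1.1 ∈ E.image Sigma.fst := fun x =>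
    Finset.mem_image_of_mem _ x.2
  refine ⟨B × (B ≃ Fin (Fintype.card B)), inferInstance, inferInstance, φ, ?_, fun g hg h hh => ?_, C, inferInstanceAs
    (Finite (Option _ × _)), Finset.univ.filter good, fun s => ⟨fun x =>
      (minLabel s.1.2 (orb (ψ (r x.1)⁻¹ s.1.1)), e ⟨x.1.1, hEmem x⟩), ?_⟩, ?_, ?_⟩
  · ext s <;> simp [φ, h1]
  · rw [normHamming_eq_density]
    refine ((density_mono fun s hs => ?_).trans hfst).trans_lt (hd.trans (half_lt_self hε))
    intro hb
    exact hs (Prod.ext (hb.1 g (hsub₂ hg) h (hsub₂ hh)) rfl)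
  · intro x y hxy
    obtain ⟨hb, -⟩ := (Finset.mem_filter.1 s.2).2
    rw [Prod.mk.injEq] at hxy
    obtain ⟨hlab, hidx⟩ := hxy
    have hidx' : x.1.1 = y.1.1 := congrArg Subtype.val (e.injective hidx)
    obtain ⟨u, hu, hlx⟩ := exists_mem_minLabel_eq s.1.2
      (U := orb (ψ (r x.1)⁻¹ s.1.1)) (hTne.image _)
    obtain ⟨v, hv, hly⟩ := exists_mem_minLabel_eq s.1.2
      (U := orb (ψ (r y.1)⁻¹ s.1.1)) (hTne.image _)
    -- Equal labels give a common point of two pieces; at a good point this forces `r x * t = r y *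
    -- t'` with `t, t'` in `A`, hence equal cosets.
    have huv : u = v := s.1.2.injective (WithTop.coe_injective (by rw [← hlx, ← hly, hlab]))
    obtain ⟨t, ht, rfl⟩ := Finset.mem_image.1 hu
    obtain ⟨t', ht', rfl⟩ := Finset.mem_image.1 hv
    rw [← hb.1 _ (hsub₃ (hTD t ht)) _ (hsub₁ (hRD _ x.2)),
      ← hb.1 _ (hsub₃ (hTD t' ht')) _ (hsub₁ (hRD _ y.2))] at huv
    have heq := hinj _ hb _ (hYD t ht _ x.2) _ (hYD t' ht' _ y.2) huv
    rw [← mul_inv_rev, ← mul_inv_rev, inv_inj] at heq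
    have hmk : x.1.2 = y.1.2 := by
      have hxy' : (r x.1)⁻¹ * r y.1 = (t : G) * (t' : G)⁻¹ := by
        rw [inv_mul_eq_iff_eq_mul, ← mul_assoc, heq, mul_inv_cancel_right]
      rw [← hr, ← hr y.1, QuotientGroup.eq, hxy']
      exact A.mul_mem t.2 (A.inv_mem t'.2)
    exact Subtype.ext (Sigma.ext hidx' (heq_of_eq hmk))
  · rw [density_not] at hgood
    have hpos : 0 < (Fintype.card (B × (B ≃ Fin (Fintype.card B))) : ℝ) := by exact_mod_cast Fintype.card_pos
    have hc : density good = ((Finset.univ.filter good).card : ℝ) / Fintype.card (B × (B ≃ Fin (Fintype.card B))) := by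
      rw [density, Nat.card_eq_fintype_card, Fintype.card_subtype]
    rw [hc] at hgood
    exact (lt_div_iff₀ hpos).1 (by linarith)
  · intro s hs g hg x hx _ hgx
    obtain ⟨hb, hlab⟩ := (Finset.mem_filter.1 hs).2
    have := hlab (g, x) (Finset.mk_mem_product hg hx)
    simp only [ne, not_and, not_not] at this
    exact Prod.ext (this hgx) rfl

/-! ### Amalgamated powers inside a free wreath product -/

/-- The embedding of an amalgamated power of `G` over `A` into the free generalized wreath product
of `ℤ` by `G`, which maps the `i`-th copy of `G` to the conjugate of `G` by the free generator
indexed by the trivial coset in the `i`-th copy of `G ⧸ A`. -/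
def AmalgPower.toFreeWreath {G : Type*} [Group G] (A : Subgroup G) (I : Type*) :
    AmalgPower A I →*
      FreeGroup (Σ _ : I, G ⧸ A) ⋊[FreeGroup.permAut G (Σ _ : I, G ⧸ A)] G :=
  Monoid.PushoutI.lift (G := fun _ : I => G) (φ := fun _ : I => A.subtype)
    (fun i => (MulAut.conj (SemidirectProduct.inl
      (FreeGroup.of (⟨i, ((1 : G) : G ⧸ A)⟩ : Σ _ : I, G ⧸ A)))).toMonoidHom.comp
        SemidirectProduct.inr)
    (SemidirectProduct.inr.comp A.subtype) (by
      intro i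
      ext a : 1
      -- `A` fixes the trivial coset, so it commutes with the conjugating generator and the copies
      -- agree on `A`.
      have hfix : (a : G) • (⟨i, ((1 : G) : G ⧸ A)⟩ : Σ _ : I, G ⧸ A) = ⟨i, ((1 : G) : G ⧸ A)⟩ := by
        refine Sigma.ext rfl (heq_of_eq ?_)
        change (((a : G) * 1 : G) : G ⧸ A) = ((1 : G) : G ⧸ A)
        rw [QuotientGroup.eq]
        simp
      refine SemidirectProduct.ext ?_ ?_
      · simp [FreeGroup.permAut_apply_of, hfix]
      · simp)

section

variable {G : Type*} [Group G] (A : Subgroup G) {I : Type*}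

/-- The word in the free generators `Σ _ : I, G ⧸ A` which is spelled by a list of elements of the
copies of `G`, starting from the coset of `g`. -/
def cosetWord : G → List (Σ _ : I, G) → List ((Σ _ : I, G ⧸ A) × Bool)
  | _, [] => []
  | g, l :: L => (⟨l.1, (g : G ⧸ A)⟩, true) :: (⟨l.1, ((g * l.2 : G) : G ⧸ A)⟩, false) ::
      cosetWord (g * l.2) L

/-- Inside a pair the cosets differ because the letter is outside `A`; between pairs the indices in
`I` differ. -/
theorem isReduced_cosetWord (g : G) (L : List (Σ _ : I, G)) (hA : ∀ l ∈ L, l.2 ∉ A)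
    (hL : L.IsChain fun l l' => l.1 ≠ l'.1) : FreeGroup.IsReduced (cosetWord A g L) := by
  induction L generalizing g with
  | nil => exact FreeGroup.IsReduced.nil
  | cons l L ih =>
    have ih' := ih (g * l.2) (fun l' h => hA l' (List.mem_cons_of_mem l h)) hL.tail
    have hl := hA l List.mem_cons_self
    have hne : (⟨l.1, (g : G ⧸ A)⟩ : Σ _ : I, G ⧸ A) ≠ ⟨l.1, ((g * l.2 : G) : G ⧸ A)⟩ := by
      intro h
      have h' : (g : G ⧸ A) = ((g * l.2 : G) : G ⧸ A) := eq_of_heq (Sigma.ext_iff.1 h).2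
      rw [QuotientGroup.eq, inv_mul_cancel_left] at h'
      exact hl h'
    rw [cosetWord, FreeGroup.isReduced_cons_cons]
    refine ⟨fun h => absurd h hne, ?_⟩
    cases L with
    | nil => exact FreeGroup.IsReduced.singleton
    | cons l' L =>
      rw [cosetWord] at ih' ⊢
      rw [FreeGroup.isReduced_cons_cons]
      refine ⟨fun h => absurd (Sigma.ext_iff.1 h).1 ?_, ih'⟩
      exact (List.isChain_cons_cons.1 hL).1

/-- Moving each group element to the right past the generators translates their cosets; the prefix
`g` accumulates these elements for the induction. -/
theorem AmalgPower.toFreeWreath_prod (g : G) (L : List (Σ _ : I, G)) :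
    SemidirectProduct.inr g *
      AmalgPower.toFreeWreath A I (L.map fun l => AmalgPower.of A l.1 l.2).prod =
    SemidirectProduct.inl (FreeGroup.mk (cosetWord A g L)) *
      SemidirectProduct.inr (g * (L.map fun l => l.2).prod) := by
  induction L generalizing g with
  | nil => simp [cosetWord, ← FreeGroup.one_eq_mk]
  | cons l L ih =>
    have hsmul : ∀ h k : G, h • (⟨l.1, (k : G ⧸ A)⟩ : Σ _ : I, G ⧸ A) =
      ⟨l.1, ((h * k : G) : G ⧸ A)⟩ := fun h k => rfl
    have hof : AmalgPower.toFreeWreath A I (AmalgPower.of A l.1 l.2) =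
        SemidirectProduct.inl (FreeGroup.of ⟨l.1, ((1 : G) : G ⧸ A)⟩) *
          SemidirectProduct.inr l.2 *
          (SemidirectProduct.inl (FreeGroup.of ⟨l.1, ((1 : G) : G ⧸ A)⟩))⁻¹ :=
      Monoid.PushoutI.lift_of (G := fun _ : I => G) (φ := fun _ : I => A.subtype) _ _ _ l.2
    have hstep : (SemidirectProduct.inr g : FreeGroup (Σ _ : I, G ⧸ A)
          ⋊[FreeGroup.permAut G (Σ _ : I, G ⧸ A)] G) *
          AmalgPower.toFreeWreath A I (AmalgPower.of A l.1 l.2) =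
        SemidirectProduct.inl (FreeGroup.of ⟨l.1, (g : G ⧸ A)⟩ *
          (FreeGroup.of ⟨l.1, ((g * l.2 : G) : G ⧸ A)⟩)⁻¹) * SemidirectProduct.inr (g * l.2) := by
      rw [hof]
      refine SemidirectProduct.ext ?_ ?_
      · simp [FreeGroup.permAut_apply_of, hsmul, -Sigma.smul_mk]
      · simp
    rw [List.map_cons, List.prod_cons, map_mul, ← mul_assoc, hstep, mul_assoc, ih, ← mul_assoc,
      ← map_mul, List.map_cons, List.prod_cons, mul_assoc g]
    congr 2

/-- On a normal form the free component is a reduced word with two letters per syllable. If it is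
trivial there are no syllables, and the `G` component detects the head. -/
theorem AmalgPower.toFreeWreath_injective (I : Type*) :
    Function.Injective (AmalgPower.toFreeWreath A I) := by
  rw [injective_iff_map_eq_one]
  intro w hw
  obtain ⟨d⟩ := Monoid.PushoutI.NormalWord.transversal_nonempty (fun _ : I => A.subtype)
    fun _ => A.subtype_injective
  classical
  obtain ⟨v, rfl⟩ := Monoid.PushoutI.NormalWord.equiv (d := d).symm.surjective w
  have hv : Monoid.PushoutI.NormalWord.equiv.symm v = AmalgPower.base A I v.head *
      (v.toList.map fun l => AmalgPower.of A l.1 l.2).prod := by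
    change v.prod = _
    rw [Monoid.PushoutI.NormalWord.prod, Monoid.CoprodI.Word.prod, map_list_prod, List.map_map]
    rfl
  -- A syllable lies in a transversal that meets `A` only in `1`, and it is not `1`.
  have hmem : ∀ l ∈ v.toList, l.2 ∉ A := by
    intro l hl hlA
    have hset := v.normalized l.1 l.2 hl
    have hc := (d.compl l.1).1
    have : ((⟨l.2, ⟨⟨l.2, hlA⟩, rfl⟩⟩, ⟨1, d.one_mem l.1⟩) :
        Prod (A.subtype.range : Set G) (d.set l.1)) = (⟨1, one_mem _⟩, ⟨l.2, hset⟩) := by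
      apply hc
      simp
    exact v.ne_one l hl (congrArg (fun p => (p.2 : G)) this).symm
  have hbase : AmalgPower.toFreeWreath A I (AmalgPower.base A I v.head) =
      SemidirectProduct.inr (v.head : G) :=
    Monoid.PushoutI.lift_base (G := fun _ : I => G) (φ := fun _ : I => A.subtype) _ _ _ v.head
  rw [hv, map_mul, hbase, AmalgPower.toFreeWreath_prod] at hw
  have hleft := congrArg SemidirectProduct.left hw
  have hright := congrArg SemidirectProduct.right hw
  simp only [SemidirectProduct.mul_left, SemidirectProduct.left_inl, SemidirectProduct.right_inl,
    map_one, SemidirectProduct.left_inr, mul_one, SemidirectProduct.one_left] at hleft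
  have hnil : cosetWord A (v.head : G) v.toList = [] := by
    have := (isReduced_cosetWord A (v.head : G) v.toList hmem v.chain_ne).reduce_eq
    rw [← this, ← FreeGroup.toWord_mk, hleft, FreeGroup.toWord_one]
  have hlist : v.toList = [] := by
    cases h : v.toList with
    | nil => rfl
    | cons l L => rw [h, cosetWord] at hnil; exact absurd hnil (List.cons_ne_nil _ _)
  rw [hlist] at hright
  have hhead : v.head = 1 := by
    apply Subtype.ext
    simpa using hright
  rw [hv, hlist, hhead]
  simp

end

/-- The amalgamated free products of copies of a sofic group over an amenable subgroup are sofic. -/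
theorem IsSofic.amalgPower {G : Type*} [Group G] (hG : IsSofic G) {A : Subgroup G}
    (hA : IsAmenable A) (I : Type*) : IsSofic (AmalgPower A I) :=
  (hG.freeGroup_semidirectProduct (hG.isSoficAction_cosets hA I)).of_injective
    (AmalgPower.toFreeWreath A I) (AmalgPower.toFreeWreath_injective A I)

theorem isAmenable_of_subsingleton (K : Type*) [Group K] [Subsingleton K] : IsAmenable K := by
  intro F ε hε
  refine ⟨{1}, Finset.singleton_nonempty 1, fun g _ => ?_⟩
  rw [Subsingleton.elim g 1]
  simpa using hε

theorem theorem3p6 {G H X : Type*} [Group G] [Countable G] [Group H] [Countable H]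
    [Countable X] [MulAction H X] (hH : IsSofic H) (hα : IsSoficAction H X) :
    (∀ A : Subgroup G,
      (∀ (I : Type) [Countable I], IsSofic (AmalgPower A I)) →
        IsSofic (AmalgFreeWreath A H X)) ∧
    (IsSofic G → IsSofic (AmalgFreeWreath (⊥ : Subgroup G) H X)) ∧
    (IsSofic G → ∀ A : Subgroup G, IsAmenable A → IsSofic (AmalgFreeWreath A H X)) :=
  ⟨fun A hA => isSofic_amalgFreeWreath hH hα A hA,
    fun hG => isSofic_amalgFreeWreath hH hα ⊥ fun I _ =>
      hG.amalgPower (isAmenable_of_subsingleton _) I,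
    fun hG A hA => isSofic_amalgFreeWreath hH hα A fun I _ => hG.amalgPower hA I⟩
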